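/- Let $A(x)=1+\sum_{n\ge 1}a_nx^n$ and $B(x)=1+\sum_{n\ge 1}b_nx^n$ be power series with real coefficients satisfying the identity of formal power series $B(x)=A(xB(x))$, and let $R$ and $r$ be the radii of convergence of $A$ and $B$, respectively, with $R,r\in(0,\infty]$. Assume that $a_n\ge 0$ for all $n\ge 1$ and that $\gcd\{n\ge 1: a_n>0\}=1$. Then $b_n\ge 0$ for all $n$, $r<\infty$, and, with $B(r)=1+\sum_{n\ge 1}b_nr^n\in[0,\infty]$, \[ b_nr^n\ne\Theta(n^{-3/2})\ \text{ as } n\to\infty\quad\Longrightarrow\quad R=rB(r), \] where both sides of the last equation may be $+\infty$. Here $b_nr^n=\Theta(n^{-3/2})$ means that there are constants $c,C>0$ such that $c\,n^{-3/2}\le b_nr^n\le C\,n^{-3/2}$ for all sufficiently large $n$. -/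

import Mathlib

open scoped ENNReal
open Asymptotics Filter

noncomputable section

/-- The radius of convergence, in `[0, ∞]`, of a formal power series with real coefficients. -/
def radiusOfConvergence (F : PowerSeries ℝ) : ℝ≥0∞ :=
  (FormalMultilinearSeries.ofScalars ℝ (fun n : ℕ => PowerSeries.coeff n F)).radius

/-- The sum `∑ n, f_n x ^ n`, in `[0, ∞]`, of a power series with nonnegative coefficients `f_n`
at a point `x` of `[0, ∞]`. -/
def extendedValue (F : PowerSeries ℝ) (x : ℝ≥0∞) : ℝ≥0∞ :=
  ∑' n : ℕ, ENNReal.ofReal (PowerSeries.coeff n F) * x ^ n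

end

/-! Lagrange inversion, `(n + 1) b_n = [x^n] A^(n+1)`, gives `b_n ≥ 0`. The functional equation then
holds for values in `[0, ∞]`; keeping one term `a_k x^k` of `A` forces `r < ∞`, and letting `x ↑ r`
gives `r B(r) ≤ R`.

Suppose `τ = r B(r) < R`. Then `P(y) = A(τ y) / B(r)` is a probability generating function, and `b_n
r^n = B(r) [y^n] P^(n+1) / (n + 1)`: up to the factor `B(r) / (n + 1)`, this is the probability that
`n + 1` independent copies sum to `n`. A local limit theorem makes that probability of exact order
`n^(-1/2)`, provided that the mean is one.

The mean is one because `τ` minimizes `A(s) / s` on `(0, R)`: the bound `[x^n] A^(n+1) s^n ≤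
A(s)^(n+1)` yields `s ≤ r A(s)` for all `s < R` (`le_radius_mul_extendedValue`), with equality at
`τ`. Since `τ` is interior, the derivative vanishes there and all moments are finite. The gcd
condition supplies aperiodicity. -/

section LagrangeInversion

/-! ### Lagrange inversion for formal power series. -/

open PowerSeries

variable {K : Type*} [Field K]

/-- With `w = xB`, this is the residue of `w^(-m-1) w'`: zero for `m ≠ 0`, where it is the
derivative of `-w^(-m) / m`, and one for the logarithmic derivative. -/
theorem coeff_inv_pow_mul_derivative_X_mul [CharZero K] {B : PowerSeries K}
    (hB : constantCoeff B ≠ 0) (m : ℕ) :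
    coeff m (B⁻¹ ^ (m + 1) * d⁄dX K (X * B)) = if m = 0 then 1 else 0 := by
  have hBC : B * B⁻¹ = 1 := PowerSeries.mul_inv_cancel B hB
  have hD : d⁄dX K (X * B) = B + X * d⁄dX K B := by
    rw [Derivation.leibniz, derivative_X]; simp [smul_eq_mul, add_comm]
  rcases m with _ | m
  · rw [hD, mul_add, zero_add, pow_one, mul_comm B⁻¹ B, hBC]
    simp
  · have hd : d⁄dX K (B⁻¹) = -(B⁻¹ ^ 2 * d⁄dX K B) := by
      rw [derivative_inv']; ring
    -- Laurent-free form of exactness: `x d/dx` multiplies the coefficient of degree `m + 1` by `m +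
    -- 1`, so the right side has none in that degree.
    have key : ((m + 1 : ℕ) : PowerSeries K) * (B⁻¹ ^ (m + 1 + 1) * d⁄dX K (X * B)) =
        ((m + 1 : ℕ) : PowerSeries K) * B⁻¹ ^ (m + 1) - X * d⁄dX K (B⁻¹ ^ (m + 1)) := by
      rw [hD, Derivation.leibniz_pow, hd]
      simp only [smul_eq_mul, nsmul_eq_mul, Nat.add_sub_cancel]
      linear_combination ((m + 1 : ℕ) : PowerSeries K) * B⁻¹ ^ (m + 1) * hBC
    have := congrArg (coeff (m + 1)) key
    rw [map_sub, coeff_succ_X_mul, coeff_derivative, ← nsmul_eq_mul, ← nsmul_eq_mul, map_nsmul,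
      map_nsmul, nsmul_eq_mul, nsmul_eq_mul] at this
    have hne : ((m + 1 : ℕ) : K) ≠ 0 := Nat.cast_ne_zero.mpr m.succ_ne_zero
    rw [if_neg m.succ_ne_zero]
    refine (mul_eq_zero.mp (this.trans ?_)).resolve_left hne
    push_cast; ring

theorem lagrange_inversion [CharZero K] {A B : PowerSeries K} (hB : constantCoeff B ≠ 0)
    (hAB : B = PowerSeries.subst (X * B) A) (n : ℕ) :
    ((n : K) + 1) * coeff n B = coeff n (A ^ (n + 1)) := by
  have hs : HasSubst (X * B) := HasSubst.of_constantCoeff_zero' (by simp)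
  have hBC : B * B⁻¹ = 1 := PowerSeries.mul_inv_cancel B hB
  set D := d⁄dX K (X * B) with hD
  have hDn : coeff n D = ((n : K) + 1) * coeff n B := by
    rw [hD, coeff_derivative, coeff_succ_X_mul, mul_comm]
  obtain ⟨G, hG⟩ : ∃ G : PowerSeries K,
      A ^ (n + 1) = X ^ (n + 1) * G + ((trunc (n + 1) (A ^ (n + 1)) : Polynomial K) : PowerSeries K) :=
    ⟨_, eq_X_pow_mul_shift_add_trunc (n + 1) (A ^ (n + 1))⟩
  have h1 : B ^ (n + 1) = (X * B) ^ (n + 1) * subst (X * B) G +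
      ∑ k ∈ Finset.range (n + 1), C (coeff k (A ^ (n + 1))) * (X * B) ^ k := by
    conv_lhs => rw [hAB, ← subst_pow hs, hG]
    rw [subst_add hs, subst_mul hs, subst_pow hs, subst_X hs, subst_coe hs]
    congr 1
    exact eval₂_trunc_eq_sum_range (X * B) (algebraMap K (PowerSeries K)) (n + 1) (A ^ (n + 1))
  -- Multiplying by `B⁻¹ ^ (n + 1) * D` prepares for residues: the tail starts in degree `n + 1`,
  -- and in degree `n` only the summand `k = n` survives.
  have h2 : D = X ^ (n + 1) * (subst (X * B) G * D) +
      ∑ k ∈ Finset.range (n + 1),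
        C (coeff k (A ^ (n + 1))) * (X ^ k * (B⁻¹ ^ (n - k + 1) * D)) := by
    have hp (k : ℕ) : B ^ k * B⁻¹ ^ k = 1 := by rw [← mul_pow, hBC, one_pow]
    calc D = B ^ (n + 1) * B⁻¹ ^ (n + 1) * D := by rw [hp, one_mul]
      _ = _ := by
        rw [h1, add_mul, add_mul, Finset.sum_mul, Finset.sum_mul]
        congr 1
        · rw [mul_pow]
          linear_combination (X ^ (n + 1) * subst (X * B) G * D) * hp (n + 1)
        · refine Finset.sum_congr rfl fun k hk => ?_
          have hk' : n + 1 = k + (n - k + 1) := by have := Finset.mem_range.mp hk; omega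
          have : B⁻¹ ^ (n + 1) = B⁻¹ ^ k * B⁻¹ ^ (n - k + 1) := by rw [← pow_add, ← hk']
          rw [this, mul_pow]
          linear_combination (C (coeff k (A ^ (n + 1))) * X ^ k * B⁻¹ ^ (n - k + 1) * D) * hp k
  rw [← hDn, h2, map_add, map_sum, coeff_X_pow_mul', if_neg (by omega), zero_add,
    Finset.sum_range_succ]
  rw [Finset.sum_eq_zero, zero_add, coeff_C_mul, coeff_X_pow_mul', if_pos le_rfl, Nat.sub_self]
  · have := coeff_inv_pow_mul_derivative_X_mul hB 0
    rw [this]; simp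
  · intro k hk
    have hk' := Finset.mem_range.mp hk
    rw [coeff_C_mul, coeff_X_pow_mul', if_pos hk'.le, coeff_inv_pow_mul_derivative_X_mul hB,
      if_neg (by omega), mul_zero]

end LagrangeInversion

/-! ### Evaluation in `[0, ∞]`, where nonnegative sums may be rearranged freely. -/

section ExtendedValue

open PowerSeries

variable {F G : PowerSeries ℝ}

theorem coeff_mul_nonneg (hF : ∀ n, 0 ≤ coeff n F) (hG : ∀ n, 0 ≤ coeff n G) (n : ℕ) :
    0 ≤ coeff n (F * G) := by
  rw [coeff_mul]
  exact Finset.sum_nonneg fun i _ => mul_nonneg (hF _) (hG _)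

theorem coeff_pow_nonneg (hF : ∀ n, 0 ≤ coeff n F) (k n : ℕ) : 0 ≤ coeff n (F ^ k) := by
  induction k generalizing n with
  | zero => rw [pow_zero, coeff_one]; split_ifs <;> simp
  | succ k ih => rw [pow_succ]; exact coeff_mul_nonneg ih hF n

theorem extendedValue_mul (hF : ∀ n, 0 ≤ coeff n F) (hG : ∀ n, 0 ≤ coeff n G) (x : ℝ≥0∞) :
    extendedValue (F * G) x = extendedValue F x * extendedValue G x := by
  rw [mul_comm F G]
  unfold extendedValue
  simp_rw [← ENNReal.tsum_mul_left, ← ENNReal.tsum_mul_right]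
  rw [← ENNReal.tsum_prod, ← Equiv.tsum_eq Finset.HasAntidiagonal.sigmaAntidiagonalEquivProd, ENNReal.tsum_sigma']
  refine tsum_congr fun n => ?_
  rw [tsum_fintype, coeff_mul, ENNReal.ofReal_sum_of_nonneg fun i _ => mul_nonneg (hG _) (hF _),
    Finset.sum_mul]
  rw [Finset.univ_eq_attach, ← Finset.sum_attach]
  refine Finset.sum_congr rfl fun i _ => ?_
  have := Finset.HasAntidiagonal.mem_antidiagonal.mp i.2
  simp only [Finset.HasAntidiagonal.sigmaAntidiagonalEquivProd_apply]
  have hx : x ^ n = x ^ (i : ℕ × ℕ).1 * x ^ (i : ℕ × ℕ).2 := by rw [← pow_add, this]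
  rw [ENNReal.ofReal_mul (hG _), hx]
  ring

theorem extendedValue_one (x : ℝ≥0∞) : extendedValue 1 x = 1 := by
  unfold extendedValue
  rw [tsum_eq_single 0 fun n hn => by simp [coeff_one, hn]]
  simp

theorem extendedValue_X (x : ℝ≥0∞) : extendedValue X x = x := by
  unfold extendedValue
  rw [tsum_eq_single 1 fun n hn => by simp [coeff_X, hn]]
  simp

theorem extendedValue_pow (hF : ∀ n, 0 ≤ coeff n F) (k : ℕ) (x : ℝ≥0∞) :
    extendedValue (F ^ k) x = extendedValue F x ^ k := by
  induction k with
  | zero => simp [extendedValue_one]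
  | succ k ih => rw [pow_succ, extendedValue_mul (coeff_pow_nonneg hF k) hF, ih, pow_succ]

theorem coeff_X_mul_nonneg (hF : ∀ n, 0 ≤ coeff n F) (n : ℕ) : 0 ≤ coeff n (X * F) :=
  coeff_mul_nonneg (fun m => by rw [coeff_X]; split_ifs <;> simp) hF n

theorem extendedValue_X_mul (hF : ∀ n, 0 ≤ coeff n F) (x : ℝ≥0∞) :
    extendedValue (X * F) x = x * extendedValue F x := by
  rw [extendedValue_mul (fun m => by rw [coeff_X]; split_ifs <;> simp) hF, extendedValue_X]

/-- Tonelli interchanges the two sums, so no convergence hypothesis is needed and the functional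
equation passes to values, even infinite ones. -/
theorem extendedValue_subst (hF : ∀ n, 0 ≤ coeff n F) (hG : ∀ n, 0 ≤ coeff n G)
    (hG₀ : constantCoeff G = 0) (x : ℝ≥0∞) :
    extendedValue (PowerSeries.subst G F) x = extendedValue F (extendedValue G x) := by
  have hs : HasSubst G := HasSubst.of_constantCoeff_zero' hG₀
  have hcoeff (n : ℕ) : ENNReal.ofReal (coeff n (PowerSeries.subst G F)) =
      ∑' k, ENNReal.ofReal (coeff k F) * ENNReal.ofReal (coeff n (G ^ k)) := by
    have hfin := coeff_subst_finite' hs F n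
    rw [coeff_subst' hs, finsum_eq_sum _ hfin, ENNReal.ofReal_sum_of_nonneg]
    · rw [tsum_eq_sum (s := hfin.toFinset)]
      · refine Finset.sum_congr rfl fun k _ => ?_
        rw [smul_eq_mul, ENNReal.ofReal_mul (hF k)]
      · intro k hk
        rw [← ENNReal.ofReal_mul (hF k)]
        simp only [Set.Finite.mem_toFinset, Function.mem_support, ne_eq, not_not, smul_eq_mul]
          at hk
        rw [hk, ENNReal.ofReal_zero]
    · exact fun k _ => mul_nonneg (hF k) (coeff_pow_nonneg hG k n)
  rw [extendedValue]
  simp_rw [hcoeff, ← ENNReal.tsum_mul_right]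
  rw [ENNReal.tsum_comm, extendedValue]
  refine tsum_congr fun k => ?_
  rw [← extendedValue_pow hG, extendedValue, ← ENNReal.tsum_mul_left]
  exact tsum_congr fun n => by ring

theorem coeff_le_extendedValue (n : ℕ) (x : ℝ≥0∞) :
    ENNReal.ofReal (coeff n F) * x ^ n ≤ extendedValue F x :=
  ENNReal.le_tsum n

theorem extendedValue_coe_ne_top_iff (hF : ∀ n, 0 ≤ coeff n F) (x : NNReal) :
    extendedValue F x ≠ ∞ ↔ Summable fun n => coeff n F * (x : ℝ) ^ n := by
  have h (n : ℕ) : ENNReal.ofReal (coeff n F) * (x : ℝ≥0∞) ^ n =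
      ENNReal.ofReal (coeff n F * (x : ℝ) ^ n) := by
    rw [ENNReal.ofReal_mul (hF n), ENNReal.ofReal_pow x.coe_nonneg, ENNReal.ofReal_coe_nnreal]
  unfold extendedValue
  simp_rw [h]
  constructor
  · intro hne
    have := ENNReal.summable_toReal hne
    refine this.congr fun n => ?_
    rw [ENNReal.toReal_ofReal (mul_nonneg (hF n) (by positivity))]
  · intro hs
    exact hs.tsum_ofReal_ne_top

theorem extendedValue_ne_top_of_lt_radius (hF : ∀ n, 0 ≤ coeff n F) {x : ℝ≥0∞}
    (hx : x < radiusOfConvergence F) : extendedValue F x ≠ ∞ := by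
  lift x to NNReal using hx.ne_top
  rw [extendedValue_coe_ne_top_iff hF]
  refine (FormalMultilinearSeries.summable_norm_mul_pow _ hx).congr fun n => ?_
  rw [FormalMultilinearSeries.ofScalars_norm, Real.norm_of_nonneg (hF n)]

theorem le_radius_of_extendedValue_ne_top (hF : ∀ n, 0 ≤ coeff n F) {x : ℝ≥0∞} (hx : x ≠ ∞)
    (h : extendedValue F x ≠ ∞) : x ≤ radiusOfConvergence F := by
  lift x to NNReal using hx
  rw [extendedValue_coe_ne_top_iff hF] at h
  refine FormalMultilinearSeries.le_radius_of_summable_norm _ (h.congr fun n => ?_)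
  rw [FormalMultilinearSeries.ofScalars_norm, Real.norm_of_nonneg (hF n)]

theorem one_le_extendedValue (h : coeff 0 F = 1) (x : ℝ≥0∞) : 1 ≤ extendedValue F x := by
  simpa [h] using coeff_le_extendedValue (F := F) 0 x

end ExtendedValue

/-! ### Consequences of the functional equation for the radii. -/

section FunctionalEquation

open PowerSeries

variable {A B : PowerSeries ℝ}

theorem coeff_nonneg_of_eq_subst (hA : ∀ n, 0 ≤ coeff n A) (hB₀ : coeff 0 B = 1)
    (hAB : B = PowerSeries.subst (X * B) A) (n : ℕ) : 0 ≤ coeff n B := by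
  have h := lagrange_inversion (K := ℝ) (by simpa using hB₀.trans_ne one_ne_zero) hAB n
  have h' := coeff_pow_nonneg hA (n + 1) n
  rw [← h] at h'
  exact nonneg_of_mul_nonneg_right h' (by positivity)

theorem extendedValue_eq_of_eq_subst (hA : ∀ n, 0 ≤ coeff n A) (hB : ∀ n, 0 ≤ coeff n B)
    (hAB : B = PowerSeries.subst (X * B) A) (x : ℝ≥0∞) :
    extendedValue B x = extendedValue A (x * extendedValue B x) := by
  conv_lhs => rw [hAB]
  rw [extendedValue_subst hA (coeff_X_mul_nonneg hB) (by simp), extendedValue_X_mul hB]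

theorem radius_ne_top_of_eq_subst (hA : ∀ n, 0 ≤ coeff n A) (hB : ∀ n, 0 ≤ coeff n B)
    (hB₀ : coeff 0 B = 1) (hAB : B = PowerSeries.subst (X * B) A) {k : ℕ} (hk : 1 ≤ k)
    (hak : 0 < coeff k A) : radiusOfConvergence B ≠ ∞ := by
  intro htop
  set a := ENNReal.ofReal (coeff k A) with ha
  have ha0 : a ≠ 0 := by simpa [ha] using hak
  have hatop : a ≠ ∞ := ENNReal.ofReal_ne_top
  -- Chosen so that `a x = a + 1` and `x ≥ 1`: then `β ≥ a (xβ)^k ≥ a x β = (a + 1) β`, impossible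
  -- for finite `β ≥ 1`.
  set x := 1 + a⁻¹ with hx
  have hxtop : x ≠ ∞ := by simp [hx, ha0]
  have hβtop := extendedValue_ne_top_of_lt_radius hB (htop ▸ hxtop.lt_top)
  have hβ1 := one_le_extendedValue hB₀ x
  set β := extendedValue B x with hβ
  have h1 : a * (x * β) ^ k ≤ β := by
    conv_rhs => rw [hβ, extendedValue_eq_of_eq_subst hA hB hAB]
    exact coeff_le_extendedValue k _
  have hxβ : 1 ≤ x * β := one_le_mul (by simp [hx]) hβ1
  have h2 : a * (x * β) ≤ β := le_trans (by gcongr; exact le_self_pow₀ hxβ (by omega)) h1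
  have h3 : a * x = a + 1 := by rw [hx, mul_add, mul_one, ENNReal.mul_inv_cancel ha0 hatop]
  rw [← mul_assoc, h3, add_mul, one_mul] at h2
  have h4 : β < a * β + β := by
    rw [add_comm]
    exact ENNReal.lt_add_right hβtop (mul_ne_zero ha0 (by positivity))
  exact h2.not_gt h4

/-- For `x < r` the series `A` is finite at `xB(x)`, so `xB(x) ≤ R`. The limit `x ↑ r` is taken in
partial sums, which are continuous. -/
theorem radius_mul_extendedValue_le (hA : ∀ n, 0 ≤ coeff n A) (hB : ∀ n, 0 ≤ coeff n B)
    (hAB : B = PowerSeries.subst (X * B) A) (h0 : 0 < radiusOfConvergence B) :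
    radiusOfConvergence B * extendedValue B (radiusOfConvergence B) ≤ radiusOfConvergence A := by
  set r := radiusOfConvergence B with hr
  have hlt (x : ℝ≥0∞) (hx : x < r) : extendedValue (X * B) x ≤ radiusOfConvergence A := by
    have hfin := extendedValue_ne_top_of_lt_radius hB hx
    rw [extendedValue_X_mul hB]
    refine le_radius_of_extendedValue_ne_top hA (ENNReal.mul_ne_top hx.ne_top hfin) ?_
    rwa [← extendedValue_eq_of_eq_subst hA hB hAB]
  rw [← extendedValue_X_mul hB]
  refine ENNReal.tsum_le_of_sum_range_le fun N => ?_
  have hcont : Continuous fun x : ℝ≥0∞ =>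
      ∑ n ∈ Finset.range N, ENNReal.ofReal (coeff n (X * B)) * x ^ n :=
    continuous_finsetSum _ fun n _ =>
      (ENNReal.continuous_const_mul ENNReal.ofReal_ne_top).comp (ENNReal.continuous_pow n)
  have : (nhdsWithin r (Set.Iio r)).NeBot := nhdsLT_neBot_of_exists_lt ⟨0, h0⟩
  refine le_of_tendsto (x := nhdsWithin r (Set.Iio r))
    ((hcont.tendsto r).mono_left nhdsWithin_le_nhds) ?_
  filter_upwards [self_mem_nhdsWithin] with x hx
  exact (ENNReal.sum_le_tsum _).trans (hlt x hx)

/-- Lagrange inversion and `b_n ≤ (n + 1) b_n` give `b_n s^n ≤ A(s)^(n+1)`. Hence `b_n (s / A(s))^n`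
is bounded and `s / A(s) ≤ r`. -/
theorem le_radius_mul_extendedValue (hA : ∀ n, 0 ≤ coeff n A) (hA₀ : coeff 0 A = 1)
    (hB₀ : coeff 0 B = 1) (hAB : B = PowerSeries.subst (X * B) A) {s : ℝ≥0∞}
    (hs : s < radiusOfConvergence A) : s ≤ radiusOfConvergence B * extendedValue A s := by
  have hB := coeff_nonneg_of_eq_subst hA hB₀ hAB
  have hα := extendedValue_ne_top_of_lt_radius hA hs
  have hα1 := one_le_extendedValue hA₀ s
  have hbound (n : ℕ) : ENNReal.ofReal (coeff n B) * s ^ n ≤ extendedValue A s ^ (n + 1) := by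
    rw [← extendedValue_pow hA]
    refine le_trans ?_ (coeff_le_extendedValue n s)
    gcongr
    rw [← lagrange_inversion (K := ℝ) (by simpa using hB₀.trans_ne one_ne_zero) hAB n]
    nlinarith [hB n, n.cast_nonneg (α := ℝ)]
  lift s to NNReal using hs.ne_top
  generalize extendedValue A s = α at *
  lift α to NNReal using hα
  have hα1' : (1 : NNReal) ≤ α := by exact_mod_cast hα1
  have hα0 : α ≠ 0 := (zero_lt_one.trans_le hα1').ne'
  have : ((s / α : NNReal) : ℝ≥0∞) ≤ radiusOfConvergence B := by
    refine FormalMultilinearSeries.le_radius_of_bound _ α fun n => ?_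
    rw [FormalMultilinearSeries.ofScalars_norm, Real.norm_of_nonneg (hB n)]
    have h := hbound n
    have h' : coeff n B * (s : ℝ) ^ n ≤ (α : ℝ) ^ (n + 1) := by
      have := ENNReal.toReal_mono (by simp) h
      simpa [ENNReal.toReal_ofReal (hB n)] using this
    rw [NNReal.coe_div, div_pow, mul_div_assoc', div_le_iff₀ (by positivity)]
    calc _ ≤ _ := h'
      _ = _ := by ring
  calc (s : ℝ≥0∞) = ((s / α : NNReal) : ℝ≥0∞) * α := by
        rw [← ENNReal.coe_mul, div_mul_cancel₀ _ hα0]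
    _ ≤ _ := by gcongr

end FunctionalEquation

/-! ### Laplace's method for powers of a characteristic function. -/

section GaussianDecay

open MeasureTheory Real
open scoped Topology

theorem exists_norm_le_exp_neg_mul_sq {φ : ℝ → ℂ} (hφ : Continuous φ) {v K : ℝ} (hv : 0 < v)
    (hK : 0 < K)
    (htaylor : (fun t : ℝ => φ t - (1 - v * t ^ 2 / 2 : ℝ)) =o[𝓝 0] fun t : ℝ => t ^ 2)
    (hlt : ∀ t, t ≠ 0 → |t| ≤ K → ‖φ t‖ < 1) :
    ∃ c > 0, ∀ t, |t| ≤ K → ‖φ t‖ ≤ exp (-c * t ^ 2) := by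
  have hnear : ∃ δ > 0, ∀ t, |t| < δ → ‖φ t‖ ≤ 1 - v / 4 * t ^ 2 := by
    have h1 := htaylor.def (show 0 < v / 4 by positivity)
    have h2 : ∀ᶠ t : ℝ in 𝓝 0, v * t ^ 2 / 2 < 1 := by
      have : Continuous fun t : ℝ => v * t ^ 2 / 2 := by fun_prop
      exact this.continuousAt.eventually_lt_const (by simp)
    obtain ⟨δ, hδ, h⟩ := Metric.eventually_nhds_iff.mp (h1.and h2)
    refine ⟨δ, hδ, fun t ht => ?_⟩
    obtain ⟨h3, h4⟩ := h (show dist t 0 < δ by simpa using ht)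
    rw [norm_of_nonneg (sq_nonneg t)] at h3
    have h5 : ‖((1 - v * t ^ 2 / 2 : ℝ) : ℂ)‖ = 1 - v * t ^ 2 / 2 := by
      rw [Complex.norm_real, norm_of_nonneg (by linarith)]
    have h6 := norm_le_norm_sub_add (φ t) ((1 - v * t ^ 2 / 2 : ℝ) : ℂ)
    rw [h5] at h6
    linarith
  obtain ⟨δ, hδ, hnear⟩ := hnear
  have hfar : ∃ M < 1, ∀ t, δ ≤ |t| → |t| ≤ K → ‖φ t‖ ≤ M := by
    have hcomp : IsCompact ({t : ℝ | δ ≤ |t|} ∩ Set.Icc (-K) K) :=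
      isCompact_Icc.inter_left (isClosed_le continuous_const continuous_abs)
    rcases ({t : ℝ | δ ≤ |t|} ∩ Set.Icc (-K) K).eq_empty_or_nonempty with he | hne
    · refine ⟨0, one_pos, fun t h1 h2 => ?_⟩
      exact absurd (he ▸ ⟨h1, abs_le.mp h2⟩ : t ∈ (∅ : Set ℝ)) (Set.notMem_empty t)
    · obtain ⟨t₀, ⟨h1, h2⟩, hmax⟩ := hcomp.exists_isMaxOn hne hφ.norm.continuousOn
      refine ⟨‖φ t₀‖, hlt t₀ ?_ (abs_le.mpr h2), fun t h3 h4 => hmax ⟨h3, abs_le.mp h4⟩⟩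
      rintro rfl
      simp only [Set.mem_ofPred_eq, abs_zero] at h1
      exact h1.not_gt hδ
  obtain ⟨M, hM, hfar⟩ := hfar
  -- Both regimes reduce to `1 - c t² ≤ exp (-c t²)`: the first entry serves the Taylor range, the
  -- second ensures `c t² ≤ 1 - M` for `|t| ≤ K`.
  refine ⟨min (v / 4) ((1 - M) / K ^ 2), lt_min (by positivity) (by
    have : 0 < 1 - M := by linarith
    positivity), fun t ht => ?_⟩
  refine le_trans ?_ (neg_mul (min _ _) (t ^ 2) ▸ one_sub_le_exp_neg _)
  rcases lt_or_ge |t| δ with h | h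
  · refine (hnear t h).trans ?_
    gcongr
    exact min_le_left _ _
  · refine (hfar t h ht).trans ?_
    have h1 : min (v / 4) ((1 - M) / K ^ 2) * t ^ 2 ≤ (1 - M) / K ^ 2 * K ^ 2 := by
      have : 0 ≤ 1 - M := by linarith
      rw [← sq_abs t]
      gcongr
      exact min_le_right _ _
    rw [div_mul_cancel₀ _ (by positivity)] at h1
    linarith

theorem tendsto_sqrt_mul_integral_pow_mul {φ g : ℝ → ℂ} (hφ : Continuous φ) (hg : Continuous g)
    {v c K : ℝ} (hK : 0 < K) (hc : 0 < c)
    (hlim : ∀ s : ℝ, Tendsto (fun n : ℕ => φ ((√n)⁻¹ * s) ^ n) atTop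
      (𝓝 (exp (-(v / 2) * s ^ 2) : ℝ)))
    (hbound : ∀ t, |t| ≤ K → ‖φ t‖ ≤ exp (-c * t ^ 2)) (hg1 : ∀ t, ‖g t‖ ≤ 1) :
    Tendsto (fun n : ℕ => (√n : ℂ) * ∫ t in -K..K, φ t ^ n * g t) atTop
      (𝓝 ((√(π / (v / 2)) : ℝ) * g 0)) := by
  have hval : ((√(π / (v / 2)) : ℝ) : ℂ) * g 0 =
      ∫ s : ℝ, ((exp (-(v / 2) * s ^ 2) : ℝ) : ℂ) * g 0 := by
    rw [integral_mul_const, integral_complex_ofReal, integral_gaussian]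
  -- The integrand after `t = s / √n`, extended by zero so that the Gaussian `exp (-c s²)` dominates
  -- it on the whole line.
  let F (n : ℕ) : ℝ → ℂ := (Set.Ioc (√n * -K) (√n * K)).indicator
    fun s => φ ((√n)⁻¹ * s) ^ n * g ((√n)⁻¹ * s)
  have hF : ∀ᶠ n : ℕ in atTop, ∫ s, F n s = (√n : ℂ) * ∫ t in -K..K, φ t ^ n * g t := by
    filter_upwards [eventually_gt_atTop 0] with n hn
    have hn' : 0 < √(n : ℝ) := sqrt_pos.mpr (by exact_mod_cast hn)
    have h := intervalIntegral.integral_comp_mul_left (a := √n * -K) (b := √n * K)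
      (fun t => φ t ^ n * g t) (inv_ne_zero hn'.ne')
    rw [inv_inv, inv_mul_cancel_left₀ hn'.ne', inv_mul_cancel_left₀ hn'.ne'] at h
    rw [integral_indicator measurableSet_Ioc, ← intervalIntegral.integral_of_le
      (by gcongr; linarith), h, Complex.real_smul]
  rw [hval]
  refine Tendsto.congr' hF ?_
  refine tendsto_integral_of_dominated_convergence (fun s => exp (-c * s ^ 2)) ?_
    (integrable_exp_neg_mul_sq hc) ?_ ?_
  · intro n
    refine AEStronglyMeasurable.indicator ?_ measurableSet_Ioc
    exact Continuous.aestronglyMeasurable (by fun_prop)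
  · intro n
    refine Eventually.of_forall fun s => ?_
    by_cases hs : s ∈ Set.Ioc (√n * -K) (√n * K)
    · have hn0 : 0 < √(n : ℝ) := by
        refine lt_of_le_of_ne (sqrt_nonneg _) fun h => ?_
        rw [← h] at hs
        simp at hs
      have hnn : 0 < (n : ℝ) := sqrt_pos.mp hn0
      simp only [F, Set.indicator_of_mem hs]
      have ht : |(√n)⁻¹ * s| ≤ K := by
        rw [abs_mul, abs_of_pos (inv_pos.mpr hn0), inv_mul_le_iff₀ hn0, abs_le]
        exact ⟨by linarith [hs.1], hs.2⟩
      rw [norm_mul, norm_pow]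
      calc ‖φ ((√n)⁻¹ * s)‖ ^ n * ‖g ((√n)⁻¹ * s)‖
          ≤ exp (-c * ((√n)⁻¹ * s) ^ 2) ^ n * 1 := by
            gcongr
            · exact hbound _ ht
            · exact hg1 _
        _ = exp (-c * s ^ 2) := by
            rw [mul_one, ← exp_nat_mul, mul_pow, inv_pow, sq_sqrt hnn.le]
            congr 1
            field_simp
    · simp only [F, Set.indicator_of_notMem hs, norm_zero]
      positivity
  · refine Eventually.of_forall fun s => ?_
    have hsq : Tendsto (fun n : ℕ => √(n : ℝ)) atTop atTop :=
      tendsto_sqrt_atTop.comp tendsto_natCast_atTop_atTop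
    have hzero : Tendsto (fun n : ℕ => (√(n : ℝ))⁻¹ * s) atTop (𝓝 0) := by
      simpa using (tendsto_inv_atTop_zero.comp hsq).mul_const s
    have hev : ∀ᶠ n : ℕ in atTop, φ ((√n)⁻¹ * s) ^ n * g ((√n)⁻¹ * s) = F n s := by
      filter_upwards [hsq.eventually_gt_atTop (|s| / K)] with n hn
      rw [div_lt_iff₀ hK] at hn
      have := abs_lt.mp hn
      have hs : s ∈ Set.Ioc (√n * -K) (√n * K) := ⟨by linarith [this.1], this.2.le⟩
      simp only [F, Set.indicator_of_mem hs]
    exact Tendsto.congr' hev ((hlim s).mul ((hg.tendsto 0).comp hzero))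

end GaussianDecay

/-! ### Coefficients as Fourier integrals over the unit circle. -/

section CoefficientExtraction

open PowerSeries MeasureTheory Real

variable {F G : PowerSeries ℂ}

theorem summable_norm_coeff_mul_pow (hF : Summable fun n => ‖coeff n F‖) {z : ℂ} (hz : ‖z‖ ≤ 1) :
    Summable fun n => ‖coeff n F * z ^ n‖ := by
  refine hF.of_nonneg_of_le (fun n => norm_nonneg _) fun n => ?_
  rw [norm_mul, norm_pow]
  exact mul_le_of_le_one_right (norm_nonneg _) (pow_le_one₀ (norm_nonneg z) hz)

theorem summable_norm_coeff_mul (hF : Summable fun n => ‖coeff n F‖)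
    (hG : Summable fun n => ‖coeff n G‖) : Summable fun n => ‖coeff n (F * G)‖ := by
  simp_rw [coeff_mul]
  exact summable_norm_sum_mul_antidiagonal_of_summable_norm
    (f := fun n => coeff n F) (g := fun n => coeff n G) hF hG

theorem tsum_coeff_mul (hF : Summable fun n => ‖coeff n F‖)
    (hG : Summable fun n => ‖coeff n G‖) {z : ℂ} (hz : ‖z‖ ≤ 1) :
    ∑' n, coeff n (F * G) * z ^ n =
      (∑' n, coeff n F * z ^ n) * ∑' n, coeff n G * z ^ n := by
  rw [tsum_mul_tsum_eq_tsum_sum_antidiagonal_of_summable_norm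
    (summable_norm_coeff_mul_pow hF hz) (summable_norm_coeff_mul_pow hG hz)]
  refine tsum_congr fun n => ?_
  rw [coeff_mul, Finset.sum_mul]
  refine Finset.sum_congr rfl fun i hi => ?_
  rw [← Finset.HasAntidiagonal.mem_antidiagonal.mp hi, pow_add]
  ring

theorem summable_norm_coeff_pow (hF : Summable fun n => ‖coeff n F‖) (k : ℕ) :
    Summable fun n => ‖coeff n (F ^ k)‖ := by
  induction k with
  | zero =>
    refine summable_of_ne_finset_zero (s := {0}) fun n hn => ?_
    rw [pow_zero, coeff_one, if_neg (by simpa using hn), norm_zero]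
  | succ k ih => rw [pow_succ]; exact summable_norm_coeff_mul ih hF

theorem tsum_coeff_pow (hF : Summable fun n => ‖coeff n F‖) (k : ℕ) {z : ℂ} (hz : ‖z‖ ≤ 1) :
    ∑' n, coeff n (F ^ k) * z ^ n = (∑' n, coeff n F * z ^ n) ^ k := by
  induction k with
  | zero =>
    rw [tsum_eq_single 0 fun n hn => by simp [coeff_one, hn]]
    simp
  | succ k ih => rw [pow_succ, tsum_coeff_mul (summable_norm_coeff_pow hF k) hF hz, ih, pow_succ]

theorem integral_exp_int_mul_I (m : ℤ) :
    ∫ t in -π..π, Complex.exp (m * Complex.I * t) = if m = 0 then 2 * (π : ℂ) else 0 := by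
  split_ifs with hm
  · simp [hm]; ring
  · rw [integral_exp_mul_complex (by simpa using hm), div_eq_zero_iff]
    left
    rw [sub_eq_zero, Complex.exp_eq_exp_iff_exists_int]
    exact ⟨m, by push_cast; ring⟩

theorem integral_tsum_coeff_mul_exp (hF : Summable fun n => ‖coeff n F‖) (n : ℕ) :
    ∫ t in -π..π, (∑' k, coeff k F * Complex.exp (t * Complex.I) ^ k) *
      Complex.exp (-(n * Complex.I * t)) = 2 * π * coeff n F := by
  let f (k : ℕ) : C(ℝ, ℂ) :=
    ⟨fun t => coeff k F * Complex.exp (((k - n : ℤ) : ℂ) * Complex.I * t), by fun_prop⟩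
  have hnorm (k : ℕ) (t : ℝ) : ‖f k t‖ = ‖coeff k F‖ := by
    have : ((k - n : ℤ) : ℂ) * Complex.I * t = (((k - n : ℤ) * t : ℝ) : ℂ) * Complex.I := by
      push_cast; ring
    simp only [f, ContinuousMap.coe_mk]
    rw [norm_mul, this, Complex.norm_exp_ofReal_mul_I, mul_one]
  have hsum : Summable fun k => ‖(f k).restrict (⟨Set.uIcc (-π) π, isCompact_uIcc⟩ :
      TopologicalSpace.Compacts ℝ)‖ := by
    refine hF.of_nonneg_of_le (fun k => norm_nonneg _) fun k => ?_
    refine (ContinuousMap.norm_le _ (norm_nonneg _)).mpr fun t => ?_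
    exact (hnorm k t).le
  have h := intervalIntegral.hasSum_intervalIntegral_of_summable_norm hsum
  have hterm (k : ℕ) : ∫ t in -π..π, f k t = if k = n then 2 * π * coeff n F else 0 := by
    simp only [f, ContinuousMap.coe_mk]
    rw [intervalIntegral.integral_const_mul, integral_exp_int_mul_I]
    have : ((k : ℤ) - n = 0) ↔ k = n := by omega
    simp only [this]
    split_ifs with hk
    · rw [hk]; ring
    · simp
  simp_rw [hterm] at h
  rw [← h.unique (hasSum_ite_eq n _)]
  refine intervalIntegral.integral_congr fun t _ => ?_
  simp only [f, ContinuousMap.coe_mk]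
  rw [← tsum_mul_right]
  refine tsum_congr fun k => ?_
  rw [← Complex.exp_nat_mul, mul_assoc, ← Complex.exp_add]
  congr 2
  push_cast; ring

end CoefficientExtraction

/-! ### The local limit theorem. -/

noncomputable section LocalLimit

open PowerSeries MeasureTheory ProbabilityTheory
open scoped Topology Real

/-- The probability mass function `n ↦ p_n` on `ℕ` with generating function `P`. -/
def coeffPMF (P : PowerSeries ℝ) (h : extendedValue P 1 = 1) : PMF ℕ :=
  ⟨fun n => ENNReal.ofReal (coeff n P), by
    rw [← h]
    simpa [extendedValue] using ENNReal.summable.hasSum⟩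

variable {P : PowerSeries ℝ} (h : extendedValue P 1 = 1)

theorem lintegral_coeffPMF (f : ℕ → ℝ≥0∞) :
    ∫⁻ n, f n ∂(coeffPMF P h).toMeasure = ∑' n, ENNReal.ofReal (coeff n P) * f n := by
  rw [lintegral_countable']
  refine tsum_congr fun n => ?_
  rw [PMF.toMeasure_apply_singleton _ _ (measurableSet_singleton n), mul_comm]
  rfl

include h in
theorem summable_norm_coeff_of_extendedValue_eq_one (hP : ∀ n, 0 ≤ coeff n P) :
    Summable fun n => ‖coeff n P‖ := by
  have := (extendedValue_coe_ne_top_iff hP 1).mp (by simp [h])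
  simpa [Real.norm_of_nonneg (hP _)] using this

theorem integral_coeffPMF (hP : ∀ n, 0 ≤ coeff n P) {E : Type*} [NormedAddCommGroup E]
    [NormedSpace ℝ E] [CompleteSpace E] {f : ℕ → E}
    (hf : Integrable f (coeffPMF P h).toMeasure) :
    ∫ n, f n ∂(coeffPMF P h).toMeasure = ∑' n, coeff n P • f n := by
  rw [PMF.integral_eq_tsum _ _ hf]
  refine tsum_congr fun n => ?_
  rw [show coeffPMF P h n = ENNReal.ofReal (coeff n P) from rfl, ENNReal.toReal_ofReal (hP n)]

theorem charFun_coeffPMF (hP : ∀ n, 0 ≤ coeff n P) (t : ℝ) :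
    charFun ((coeffPMF P h).toMeasure.map fun n : ℕ => (n : ℝ) - 1) t =
      Complex.exp (-(t * Complex.I)) *
        ∑' n, coeff n (PowerSeries.map Complex.ofRealHom P) * Complex.exp (t * Complex.I) ^ n := by
  rw [charFun_apply_real, integral_map (by fun_prop) (by fun_prop), integral_coeffPMF h hP,
    ← tsum_mul_left]
  · refine tsum_congr fun n => ?_
    rw [coeff_map, ← Complex.exp_nat_mul, mul_left_comm, ← Complex.exp_add, Complex.real_smul]
    simp only [Complex.ofRealHom_eq_coe]
    congr 2
    push_cast; ring
  · refine Integrable.of_bound (by fun_prop) 1 (Eventually.of_forall fun n => ?_)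
    rw [← Complex.ofReal_mul, Complex.norm_exp_ofReal_mul_I]

/-- Equality in the triangle inequality aligns every `z^n` with `p_n > 0` with the sum `w`. The
index `0` gives `w = 1`, so the order of `z` divides every `n ≥ 1` in the support, hence their gcd.
-/
theorem exp_mul_I_eq_one_of_norm_eq_one (hP : ∀ n, 0 ≤ coeff n P) (h0 : 0 < coeff 0 P)
    (hgcd : Nat.setGcd {n : ℕ | 1 ≤ n ∧ 0 < coeff n P} = 1) (hsum : HasSum (fun n => coeff n P) 1)
    {z : ℂ} (hz : ‖z‖ = 1)
    (hnorm : ‖∑' n, coeff n (PowerSeries.map Complex.ofRealHom P) * z ^ n‖ = 1) : z = 1 := by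
  set w := ∑' n, coeff n (PowerSeries.map Complex.ofRealHom P) * z ^ n with hw
  have hterm (n : ℕ) : ‖(starRingEnd ℂ) w * z ^ n‖ = 1 := by simp [hz, hnorm]
  have hs : Summable fun n => coeff n (PowerSeries.map Complex.ofRealHom P) * z ^ n := by
    refine Summable.of_norm (summable_norm_coeff_mul_pow ?_ hz.le)
    simpa [coeff_map, abs_of_nonneg (hP _)] using hsum.summable
  have hre : HasSum (fun n => coeff n P * ((starRingEnd ℂ) w * z ^ n).re) 1 := by
    have h1 := Complex.hasSum_re (hs.hasSum.mul_left ((starRingEnd ℂ) w))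
    rw [← hw, mul_comm _ w, Complex.mul_conj, Complex.normSq_eq_norm_sq, hnorm] at h1
    convert h1 using 1
    · funext n
      rw [coeff_map, mul_left_comm, Complex.ofRealHom_eq_coe, Complex.re_ofReal_mul]
    · simp
  have hdiff : HasSum (fun n => coeff n P * (1 - ((starRingEnd ℂ) w * z ^ n).re)) 0 := by
    simpa [mul_sub] using hsum.sub hre
  have hle (n : ℕ) : ((starRingEnd ℂ) w * z ^ n).re ≤ 1 := hterm n ▸ Complex.re_le_norm _
  have hzero := (hasSum_zero_iff_of_nonneg fun n => mul_nonneg (hP n) (sub_nonneg.mpr (hle n))).mp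
    hdiff
  have hone (n : ℕ) (hn : 0 < coeff n P) : (starRingEnd ℂ) w * z ^ n = 1 := by
    have h1 := congrFun hzero n
    simp only [Pi.zero_apply, mul_eq_zero, hn.ne', false_or] at h1
    have h2 : ((starRingEnd ℂ) w * z ^ n).re = 1 := by linarith
    have h3 := Complex.sq_norm_sub_sq_re ((starRingEnd ℂ) w * z ^ n)
    rw [hterm n, h2] at h3
    refine Complex.ext h2 ?_
    have : ((starRingEnd ℂ) w * z ^ n).im ^ 2 = 0 := by linarith
    simpa using this
  have hw1 : (starRingEnd ℂ) w = 1 := by simpa using hone 0 h0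
  have hdvd : orderOf z ∣ Nat.setGcd {n : ℕ | 1 ≤ n ∧ 0 < coeff n P} :=
    Nat.dvd_setGcd_iff.mpr fun n hn => orderOf_dvd_of_pow_eq_one (by simpa [hw1] using hone n hn.2)
  rw [hgcd, Nat.dvd_one, orderOf_eq_one_iff] at hdvd
  exact hdvd

theorem norm_charFun_coeffPMF_lt_one (hP : ∀ n, 0 ≤ coeff n P) (h0 : 0 < coeff 0 P)
    (hgcd : Nat.setGcd {n : ℕ | 1 ≤ n ∧ 0 < coeff n P} = 1) {t : ℝ} (ht : t ≠ 0) (htπ : |t| ≤ π) :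
    ‖charFun ((coeffPMF P h).toMeasure.map fun n : ℕ => (n : ℝ) - 1) t‖ < 1 := by
  have hprob : IsProbabilityMeasure ((coeffPMF P h).toMeasure.map fun n : ℕ => (n : ℝ) - 1) :=
    Measure.isProbabilityMeasure_map (by fun_prop)
  refine lt_of_le_of_ne (norm_charFun_le_one t) fun heq => ht ?_
  have hsum : HasSum (fun n => coeff n P) 1 := by
    have h1 : ∫ _, (1 : ℝ) ∂(coeffPMF P h).toMeasure = ∑' n, coeff n P • (1 : ℝ) :=
      integral_coeffPMF h hP (integrable_const _)
    simp only [integral_const, probReal_univ, smul_eq_mul, mul_one] at h1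
    rw [h1]
    exact (summable_norm_coeff_of_extendedValue_eq_one h hP).of_norm.hasSum
  rw [charFun_coeffPMF h hP, norm_mul, ← neg_mul, ← Complex.ofReal_neg,
    Complex.norm_exp_ofReal_mul_I, one_mul] at heq
  have h1 := exp_mul_I_eq_one_of_norm_eq_one hP h0 hgcd hsum (Complex.norm_exp_ofReal_mul_I t) heq
  obtain ⟨n, hn⟩ := Complex.exp_eq_one_iff.mp h1
  have h2 : t = n * (2 * π) := by
    have := congrArg Complex.im hn
    simpa using this
  rcases eq_or_ne n 0 with rfl | hn0
  · simpa using h2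
  · exfalso
    have h3 : (1 : ℝ) ≤ |(n : ℝ)| := by exact_mod_cast Int.one_le_abs hn0
    rw [h2, abs_mul, abs_of_pos Real.two_pi_pos] at htπ
    nlinarith [Real.pi_pos]

/-- Division by `√v` reduces to the case of unit variance. -/
theorem taylor_charFun_of_centered {Ω : Type*} [MeasurableSpace Ω] {μ : Measure Ω}
    [IsProbabilityMeasure μ] {X : Ω → ℝ} (hX : AEMeasurable X μ) (h0 : ∫ ω, X ω ∂μ = 0)
    {v : ℝ} (hv : 0 < v) (h2 : ∫ ω, X ω ^ 2 ∂μ = v) :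
    ((fun t : ℝ => charFun (μ.map X) t - (1 - v * t ^ 2 / 2 : ℝ)) =o[𝓝 0] fun t : ℝ => t ^ 2) ∧
    ∀ s : ℝ, Tendsto (fun n : ℕ => charFun (μ.map X) ((√n)⁻¹ * s) ^ n) atTop
      (𝓝 (Real.exp (-(v / 2) * s ^ 2) : ℝ)) := by
  have hsv : √v ≠ 0 := (Real.sqrt_pos.mpr hv).ne'
  have hY : AEMeasurable (fun ω => (√v)⁻¹ * X ω) μ := by fun_prop
  have hY0 : ∫ ω, (√v)⁻¹ * X ω ∂μ = 0 := by rw [integral_const_mul, h0, mul_zero]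
  have hY2 : μ[(fun ω => (√v)⁻¹ * X ω) ^ 2] = 1 := by
    simp only [Pi.pow_apply, mul_pow]
    rw [integral_const_mul, h2, inv_pow, Real.sq_sqrt hv.le, inv_mul_cancel₀ hv.ne']
  have hchar (t : ℝ) : charFun (μ.map X) t = charFun (μ.map fun ω => (√v)⁻¹ * X ω) (√v * t) := by
    rw [charFun_map_mul_comp hX, inv_mul_cancel_left₀ hsv]
  constructor
  · have ht := (taylor_charFun_two hY hY0 hY2).comp_tendsto
      (show Tendsto (fun t : ℝ => √v * t) (𝓝 0) (𝓝 0) by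
        simpa using (continuous_const_mul (√v)).tendsto 0)
    have hO : (fun t : ℝ => (√v * t) ^ 2) =O[𝓝 0] fun t : ℝ => t ^ 2 := by
      simp_rw [mul_pow]
      exact isBigO_const_mul_self _ _ _
    refine (ht.trans_isBigO hO).congr_left fun t => ?_
    simp only [Function.comp_apply]
    rw [hchar]
    congr 1
    rw [← Complex.ofReal_pow, mul_pow, Real.sq_sqrt hv.le]
    push_cast; ring
  · intro s
    have ht := tendsto_charFun_inv_sqrt_mul_pow hY hY0 hY2 (√v * s)
    have hlim : Complex.exp (-((√v * s : ℝ) : ℂ) ^ 2 / 2) =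
        (Real.exp (-(v / 2) * s ^ 2) : ℝ) := by
      rw [Complex.ofReal_exp, ← Complex.ofReal_pow, mul_pow, Real.sq_sqrt hv.le]
      congr 1
      push_cast; ring
    rw [hlim] at ht
    refine ht.congr fun n => ?_
    rw [hchar]
    congr 2
    ring

/-- A **local limit theorem** for the sum of `n + 1` independent copies of an `ℕ`-valued random
variable of mean one, with probability generating function `P`: up to a factor `√(n + 1)`, the
probability that the sum equals `n` tends to a positive limit. -/
theorem exists_tendsto_sqrt_mul_coeff_pow (hP : ∀ n, 0 ≤ coeff n P) (h0 : 0 < coeff 0 P)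
    (hgcd : Nat.setGcd {n : ℕ | 1 ≤ n ∧ 0 < coeff n P} = 1)
    (hmean : ∫ n : ℕ, ((n : ℝ) - 1) ∂(coeffPMF P h).toMeasure = 0)
    (hint : Integrable (fun n : ℕ => ((n : ℝ) - 1) ^ 2) (coeffPMF P h).toMeasure) :
    ∃ L > 0, Tendsto (fun n : ℕ => √((n : ℝ) + 1) * coeff n (P ^ (n + 1))) atTop (𝓝 L) := by
  set μ := (coeffPMF P h).toMeasure with hμ
  have hprob : IsProbabilityMeasure (μ.map fun n : ℕ => (n : ℝ) - 1) :=
    Measure.isProbabilityMeasure_map (by fun_prop)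
  set v := ∫ n : ℕ, ((n : ℝ) - 1) ^ 2 ∂μ with hv
  -- The atom at `0`, where `n - 1 ≠ 0`, excludes zero variance.
  have hvpos : 0 < v := by
    rw [hv, integral_pos_iff_support_of_nonneg (fun n => sq_nonneg _) hint]
    refine lt_of_lt_of_le ?_ (measure_mono (show ({0} : Set ℕ) ⊆ Function.support fun n : ℕ => ((n : ℝ) - 1) ^ 2 by simp))
    rw [PMF.toMeasure_apply_singleton _ _ (measurableSet_singleton 0)]
    exact ENNReal.ofReal_pos.mpr h0
  obtain ⟨htaylor, hlim⟩ := taylor_charFun_of_centered (by fun_prop) hmean hvpos hv.symm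
  set φ := charFun (μ.map fun n : ℕ => (n : ℝ) - 1) with hφ
  have hφc : Continuous φ := continuous_charFun
  obtain ⟨c, hc, hbound⟩ := exists_norm_le_exp_neg_mul_sq hφc hvpos Real.pi_pos htaylor
    fun t ht htπ => norm_charFun_coeffPMF_lt_one h hP h0 hgcd ht htπ
  have hmain := tendsto_sqrt_mul_integral_pow_mul (g := fun t => Complex.exp (t * Complex.I)) hφc
    (by fun_prop) Real.pi_pos hc hlim hbound fun t => (Complex.norm_exp_ofReal_mul_I t).le
  have hF : Summable fun n => ‖coeff n (PowerSeries.map Complex.ofRealHom P)‖ := by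
    simpa [coeff_map] using summable_norm_coeff_of_extendedValue_eq_one h hP
  -- Centring contributes `e^(-i(n+1)t)`, whereas extracting degree `n` needs `e^(-int)`; the factor
  -- `e^(it)` makes up the difference.
  have hint (n : ℕ) : ∫ t in -π..π, φ t ^ (n + 1) * Complex.exp (t * Complex.I) =
      ((2 * π * coeff n (P ^ (n + 1)) : ℝ) : ℂ) := by
    have h1 := integral_tsum_coeff_mul_exp (summable_norm_coeff_pow hF (n + 1)) n
    rw [← map_pow, coeff_map] at h1
    simp only [Complex.ofRealHom_eq_coe] at h1
    push_cast
    rw [← h1]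
    refine intervalIntegral.integral_congr fun t _ => ?_
    rw [map_pow, tsum_coeff_pow hF _ (Complex.norm_exp_ofReal_mul_I t).le, hφ,
      charFun_coeffPMF h hP, mul_pow, ← Complex.exp_nat_mul, mul_right_comm, ← Complex.exp_add,
      mul_comm]
    congr 2
    push_cast; ring
  refine ⟨√(π / (v / 2)) / (2 * π), by have := Real.pi_pos; positivity, ?_⟩
  have h2 := (Complex.continuous_re.tendsto _).comp (hmain.comp (tendsto_add_atTop_nat 1))
  have h3 := h2.div_const (2 * π)
  refine (h3.congr fun n => ?_).trans (le_of_eq ?_)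
  · simp only [Function.comp_apply]
    rw [hint, ← Complex.ofReal_mul, Complex.ofReal_re]
    push_cast
    have := Real.pi_pos
    field_simp
  · simp

end LocalLimit

/-! ### Criticality of the tilted law, and the main theorem. -/

section CriticalPoint

open PowerSeries MeasureTheory ProbabilityTheory
open scoped Topology Real

variable {P : PowerSeries ℝ} (h : extendedValue P 1 = 1)

theorem lintegral_exp_mul_coeffPMF (θ : ℝ) :
    ∫⁻ n : ℕ, ENNReal.ofReal (Real.exp (θ * ((n : ℝ) - 1))) ∂(coeffPMF P h).toMeasure =
      extendedValue P (ENNReal.ofReal (Real.exp θ)) * ENNReal.ofReal (Real.exp (-θ)) := by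
  rw [lintegral_coeffPMF, extendedValue, ← ENNReal.tsum_mul_right]
  refine tsum_congr fun n => ?_
  rw [mul_assoc, ← ENNReal.ofReal_pow (Real.exp_nonneg θ),
    ← ENNReal.ofReal_mul (p := Real.exp θ ^ n) (by positivity), ← Real.exp_nat_mul, ← Real.exp_add]
  congr 3
  ring

/-- The moment generating function of `n - 1` is `P(e^θ) e^(-θ)`. It is at least one near `θ = 0`
and equals one there, so its derivative at `0`, the mean, vanishes; finiteness near `0` gives the
second moment. -/
theorem mean_eq_zero_and_integrable_sq_of_le_extendedValue
    (hfin : ∀ᶠ θ : ℝ in 𝓝 0, extendedValue P (ENNReal.ofReal (Real.exp θ)) ≠ ∞)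
    (hle : ∀ᶠ θ : ℝ in 𝓝 0,
      ENNReal.ofReal (Real.exp θ) ≤ extendedValue P (ENNReal.ofReal (Real.exp θ))) :
    ∫ n : ℕ, ((n : ℝ) - 1) ∂(coeffPMF P h).toMeasure = 0 ∧
      Integrable (fun n : ℕ => ((n : ℝ) - 1) ^ 2) (coeffPMF P h).toMeasure := by
  set μ := (coeffPMF P h).toMeasure with hμ
  let X : ℕ → ℝ := fun n => (n : ℝ) - 1
  have hmem : 0 ∈ interior (integrableExpSet X μ) := by
    rw [mem_interior_iff_mem_nhds]
    filter_upwards [hfin] with θ hθ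
    refine ⟨by fun_prop, ?_⟩
    rw [hasFiniteIntegral_iff_ofReal (Eventually.of_forall fun _ => Real.exp_nonneg _),
      lintegral_exp_mul_coeffPMF]
    exact ENNReal.mul_lt_top hθ.lt_top ENNReal.ofReal_lt_top
  refine ⟨?_, by simpa using integrable_pow_of_mem_interior_integrableExpSet hmem 2⟩
  have hmin : IsLocalMin (mgf X μ) 0 := by
    filter_upwards [hle, hfin] with θ h1 h2
    rw [mgf_zero, mgf, integral_eq_lintegral_of_nonneg_ae
      (Eventually.of_forall fun _ => Real.exp_nonneg _) (by fun_prop), lintegral_exp_mul_coeffPMF]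
    have h3 : 1 ≤ extendedValue P (ENNReal.ofReal (Real.exp θ)) *
        ENNReal.ofReal (Real.exp (-θ)) := by
      calc (1 : ℝ≥0∞) = ENNReal.ofReal (Real.exp θ) * ENNReal.ofReal (Real.exp (-θ)) := by
            rw [← ENNReal.ofReal_mul (Real.exp_nonneg θ), ← Real.exp_add]; simp
        _ ≤ _ := by gcongr
    exact ENNReal.toReal_mono (ENNReal.mul_ne_top h2 ENNReal.ofReal_ne_top) h3
  have := hmin.deriv_eq_zero
  rwa [deriv_mgf_zero hmem] at this

theorem extendedValue_C_mul_rescale {A : PowerSeries ℝ} {α τ : ℝ} (hα : 0 ≤ α) (hτ : 0 ≤ τ)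
    (y : ℝ≥0∞) : extendedValue (C α * rescale τ A) y =
      ENNReal.ofReal α * extendedValue A (ENNReal.ofReal τ * y) := by
  unfold extendedValue
  rw [← ENNReal.tsum_mul_left]
  refine tsum_congr fun n => ?_
  rw [coeff_C_mul, coeff_rescale, ENNReal.ofReal_mul hα, ENNReal.ofReal_mul (by positivity),
    ENNReal.ofReal_pow hτ, mul_pow]
  ring

theorem isTheta_of_tendsto_sqrt_mul {u : ℕ → ℝ} {L : ℝ} (hL : L ≠ 0)
    (hu : Tendsto (fun n : ℕ => √((n : ℝ) + 1) * u n) atTop (𝓝 L)) :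
    (fun n : ℕ => u n / ((n : ℝ) + 1)) =Θ[atTop] fun n : ℕ => (n : ℝ) ^ (-(3 / 2) : ℝ) := by
  refine (isTheta_of_div_tendsto_nhds_ne_zero (c := L) ?_ hL).symm
  -- Accounts for comparing with `n^(-3/2)` instead of `(n + 1)^(-3/2)`.
  have h1 : Tendsto (fun n : ℕ => ((n : ℝ) / (n + 1)) ^ (3 / 2 : ℝ)) atTop (𝓝 1) := by
    have := (tendsto_natCast_div_add_atTop (1 : ℝ)).rpow_const (p := 3 / 2) (by norm_num)
    simpa using this
  have h2 := hu.mul h1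
  rw [mul_one] at h2
  refine h2.congr' ?_
  filter_upwards [eventually_gt_atTop 0] with n hn
  have hn' : (0 : ℝ) < n := by exact_mod_cast hn
  have hn1 : (0 : ℝ) < n + 1 := by positivity
  have h3 : ((n : ℝ) + 1) ^ (3 / 2 : ℝ) = (n + 1) * √((n : ℝ) + 1) := by
    rw [Real.sqrt_eq_rpow, ← Real.rpow_one_add' hn1.le (by norm_num)]
    norm_num
  rw [Real.div_rpow hn'.le hn1.le, h3, Real.rpow_neg hn'.le]
  have : 0 < √((n : ℝ) + 1) := Real.sqrt_pos.mpr hn1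
  field_simp

variable {A B : PowerSeries ℝ}

/-- In the subcritical case `r B(r) < R` the coefficients of `B` have the square-root-singularity
asymptotics `b_n r ^ n = Θ(n ^ (-3 / 2))`. -/
theorem isTheta_coeff_of_lt (hA₀ : coeff 0 A = 1) (hB₀ : coeff 0 B = 1)
    (hAB : B = PowerSeries.subst (X * B) A) (hA : ∀ n, 0 ≤ coeff n A)
    (hgcd : Nat.setGcd {n : ℕ | 1 ≤ n ∧ 0 < coeff n A} = 1)
    (hpos : 0 < radiusOfConvergence B) (hfin : radiusOfConvergence B ≠ ∞)
    (hlt : radiusOfConvergence B * extendedValue B (radiusOfConvergence B) <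
      radiusOfConvergence A) :
    (fun n : ℕ => coeff n B * (radiusOfConvergence B).toReal ^ n)
      =Θ[atTop] fun n : ℕ => (n : ℝ) ^ (-(3 / 2) : ℝ) := by
  have hB := coeff_nonneg_of_eq_subst hA hB₀ hAB
  have hmax (s : ℝ≥0∞) := le_radius_mul_extendedValue (s := s) hA hA₀ hB₀ hAB
  have hfun := extendedValue_eq_of_eq_subst hA hB hAB (radiusOfConvergence B)
  have hβ1 := one_le_extendedValue hB₀ (radiusOfConvergence B)
  set r := radiusOfConvergence B
  set β := extendedValue B r
  have hβfin : β ≠ ∞ := hfun ▸ extendedValue_ne_top_of_lt_radius hA hlt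
  have hr : 0 < r.toReal := ENNReal.toReal_pos hpos.ne' hfin
  have hβ : 0 < β.toReal := ENNReal.toReal_pos (zero_lt_one.trans_le hβ1).ne' hβfin
  set τ : ℝ := r.toReal * β.toReal with hτ
  have hτpos : 0 < τ := mul_pos hr hβ
  have hτr : ENNReal.ofReal τ = r * β := by
    rw [hτ, ← ENNReal.toReal_mul, ENNReal.ofReal_toReal (ENNReal.mul_ne_top hfin hβfin)]
  have hβinv : ENNReal.ofReal β.toReal⁻¹ = β⁻¹ := by
    rw [ENNReal.ofReal_inv_of_pos hβ, ENNReal.ofReal_toReal hβfin]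
  have hβ0 : β ≠ 0 := (zero_lt_one.trans_le hβ1).ne'
  set P : PowerSeries ℝ := C β.toReal⁻¹ * rescale τ A with hPdef
  have hPcoeff (n : ℕ) : coeff n P = β.toReal⁻¹ * (τ ^ n * coeff n A) := by
    rw [hPdef, coeff_C_mul, coeff_rescale]
  have hPval (y : ℝ≥0∞) : extendedValue P y = β⁻¹ * extendedValue A (r * β * y) := by
    rw [hPdef, extendedValue_C_mul_rescale (by positivity) hτpos.le, hβinv, hτr]
  have hP (n : ℕ) : 0 ≤ coeff n P := by
    rw [hPcoeff]
    have := hA n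
    positivity
  have hP0 : 0 < coeff 0 P := by
    rw [hPcoeff, hA₀]
    positivity
  have hPgcd : Nat.setGcd {n : ℕ | 1 ≤ n ∧ 0 < coeff n P} = 1 := by
    convert hgcd using 5 with n
    rw [hPcoeff]
    simp [hβ, pow_pos hτpos n]
  have hP1 : extendedValue P 1 = 1 := by
    rw [hPval, mul_one, ← hfun, ENNReal.inv_mul_cancel hβ0 hβfin]
  have hnear : ∀ᶠ θ : ℝ in 𝓝 0, r * β * ENNReal.ofReal (Real.exp θ) < radiusOfConvergence A := by
    have hc : Continuous fun θ : ℝ => r * β * ENNReal.ofReal (Real.exp θ) :=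
      (ENNReal.continuous_const_mul (ENNReal.mul_ne_top hfin hβfin)).comp
        (ENNReal.continuous_ofReal.comp Real.continuous_exp)
    exact hc.continuousAt.eventually_lt_const (by simpa using hlt)
  obtain ⟨hmean, hint⟩ := mean_eq_zero_and_integrable_sq_of_le_extendedValue hP1
    (by
      filter_upwards [hnear] with θ hθ
      rw [hPval]
      exact ENNReal.mul_ne_top (ENNReal.inv_ne_top.mpr hβ0)
        (extendedValue_ne_top_of_lt_radius hA hθ))
    (by
      filter_upwards [hnear] with θ hθ
      -- At `s = τ e^θ`, cancelling `r` in `s ≤ r A(s)` leaves `β e^θ ≤ A(τ e^θ)`, that is `e^θ ≤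
      -- P(e^θ)`.
      have h1 := hmax _ hθ
      rw [mul_assoc, ENNReal.mul_le_mul_iff_right hpos.ne' hfin, ← mul_assoc] at h1
      rw [hPval]
      calc ENNReal.ofReal (Real.exp θ) = β⁻¹ * (β * ENNReal.ofReal (Real.exp θ)) := by
            rw [← mul_assoc, ENNReal.inv_mul_cancel hβ0 hβfin, one_mul]
        _ ≤ _ := by gcongr)
  obtain ⟨L, hL, hlim⟩ := exists_tendsto_sqrt_mul_coeff_pow hP1 hP hP0 hPgcd hmean hint
  have hlim' : Tendsto (fun n : ℕ => √((n : ℝ) + 1) * (β.toReal * coeff n (P ^ (n + 1)))) atTop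
      (𝓝 (β.toReal * L)) := (hlim.const_mul β.toReal).congr fun n => by ring
  -- The powers of `β` cancel: `β · β^(-(n+1)) · τ^n = r^n`.
  have hcoeff (n : ℕ) : β.toReal * coeff n (P ^ (n + 1)) / ((n : ℝ) + 1) =
      coeff n B * r.toReal ^ n := by
    have hlag := lagrange_inversion (K := ℝ) (by simpa using hB₀.trans_ne one_ne_zero) hAB n
    rw [hPdef, mul_pow, ← map_pow, ← map_pow, coeff_C_mul, coeff_rescale, ← hlag, hτ, inv_pow, mul_pow _ _ n,
      pow_succ]
    field_simp
  simpa only [hcoeff] using isTheta_of_tendsto_sqrt_mul (by positivity) hlim'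

end CriticalPoint

theorem theorem2 (A B : PowerSeries ℝ) (R r : ℝ≥0∞)
    (hA₀ : PowerSeries.coeff 0 A = 1) (hB₀ : PowerSeries.coeff 0 B = 1)
    (hAB : B = PowerSeries.subst (PowerSeries.X * B) A)
    (hR : R = radiusOfConvergence A) (hr : r = radiusOfConvergence B)
    (hRpos : 0 < R) (hrpos : 0 < r)
    (hA : ∀ n : ℕ, 1 ≤ n → 0 ≤ PowerSeries.coeff n A)
    (hgcd : Nat.setGcd {n : ℕ | 1 ≤ n ∧ 0 < PowerSeries.coeff n A} = 1) :
    (∀ n : ℕ, 0 ≤ PowerSeries.coeff n B) ∧ r ≠ ∞ ∧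
      (¬ ((fun n : ℕ => PowerSeries.coeff n B * r.toReal ^ n)
          =Θ[atTop] fun n : ℕ => (n : ℝ) ^ (-(3 / 2) : ℝ)) →
        R = r * extendedValue B r) := by
  subst hR hr
  have hA' (n : ℕ) : 0 ≤ PowerSeries.coeff n A := by
    rcases n.eq_zero_or_pos with rfl | hn
    · rw [hA₀]; exact zero_le_one
    · exact hA n hn
  have hB := coeff_nonneg_of_eq_subst hA' hB₀ hAB
  obtain ⟨k, ⟨hk, hak⟩, -⟩ := Nat.exists_ne_zero_of_setGcd_ne_zero (hgcd.trans_ne one_ne_zero)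
  have hfin := radius_ne_top_of_eq_subst hA' hB hB₀ hAB hk hak
  refine ⟨hB, hfin, fun hnot => ?_⟩
  by_contra hne
  exact hnot (isTheta_coeff_of_lt hA₀ hB₀ hAB hA' hgcd hrpos hfin
    (lt_of_le_of_ne (radius_mul_extendedValue_le hA' hB hAB hrpos) (Ne.symm hne)))
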